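/- \textbf{Model.} Two nodes have energy buffers of capacities $B_1,B_2$ and battery levels $U_{j,k}\in\{0,\dots,B_j\}$ at channel use $k$; the initial state $u_0=(U_{1,1},U_{2,1})$ is fixed. Node $j$ sends a bit $X_{j,k}$, and must send $X_{j,k}=0$ if $U_{j,k}=0$. Node 2 receives $Y_{2,k}$ through a binary channel $p(y_2|x_1)$ with input $X_{1,k}$, and Node 1 receives $Y_{1,k}$ through a binary channel $p(y_1|x_2)$ with input $X_{2,k}$. Node $j$ stores $H_{j,k}\in\{0,1\}$ energy units, where $H_{j,k}$ is the output of a binary channel $p(h_j|y_j)$ with input $Y_{j,k}$, and $U_{j,k+1}=\min(U_{j,k}-X_{j,k}+H_{j,k},\,B_j)$. These four channels are arbitrary, memoryless and mutually independent. \textbf{Codes with Local Energy Information.} Node $j$ has a message $M_j$; $M_1,M_2$ are independent and uniform on $\lceil 2^{nR_1}\rceil$ and $\lceil 2^{nR_2}\rceil$ values. At channel use $k\le n$ it computes $X_{j,k}$ from $M_j$, $Y_j^{k-1}$ and its own levels $U_j^{k}$; it decodes the other message from $M_j$, $Y_j^n$ and $U_j^n$. A pair $(R_1,R_2)$ of nonnegative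 rates is achievable (from $u_0$) if for every $\varepsilon>0$ and all sufficiently large $n$ there is such a code for which the probability that some decoder errs is at most $\varepsilon$. The capacity region is the closure of the set of achievable pairs. A \emph{Shannon-strategy code} is such a code in which Node $j$ assigns to each message a codeword $v_{j,1},\dots,v_{j,n}$ of vectors $v_{j,k}\in\{0,1\}^{B_j}$ and sends $X_{j,k}=f_j(v_{j,k},U_{j,k})$, where $f_j(v,u)$ is the $u$-th bit of $v$ for $u\ge1$ and $f_j(v,0)=0$, and in which each decoder uses only its received symbols $Y_j^n$. \textbf{Statement.} Let $p(v_1)$, $p(v_2)$ be any pmfs on $\{0,1\}^{B_1}$, $\{0,1\}^{B_2}$. They induce a Markov chain on the states $(u_1,u_2)$: at each channel use $V_1\sim p(v_1)$ and $V_2\sim p(v_2)$ are drawn independently of each other and of the past, and $X_j=f_j(V_j,U_j)$ is sent. Assume that this chain, started at $u_0$, is ergodic, in the sense that there is exactly one stationary distribution $\pi(u_1,u_2)$ carried by the states accessible from $u_0$. Let $\pi(u_1)$, $\pi(u_2)$ be its marginals, and let $$p(v_1,y_2)=p(v_1)\sum_{u_1=0}^{B_1}\pi(u_1)\,p(y_2|f_1(v_1,u_1)),\qquad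 p(v_2,y_1)=p(v_2)\sum_{u_2=0}^{B_2}\pi(u_2)\,p(y_1|f_2(v_2,u_2)).$$ Then every pair of nonnegative rates (in bits per channel use) with $$R_1\le I(V_1;Y_2),\qquad R_2\le I(V_2;Y_1)$$ lies in the closure of the set of rate pairs achievable with Shannon-strategy codes; in particular it lies in the capacity region with Local Energy Information. -/

import Mathlib

noncomputable section

namespace EnergyExchange

/-- Possible battery levels `0, …, B` of a node with a buffer of capacity `B`. -/
abbrev Level (B : ℕ) : Type := Fin (B + 1)

/-- Battery update: a node with `u` units that spends `x` units (`x = 1` only if `u ≥ 1`) and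
harvests `h` units then holds `u - x + h` units, truncated at the capacity `B`. -/
def nextLevel {B : ℕ} (u : Level B) (x h : Bool) : Level B :=
  ⟨min ((u : ℕ) - x.toNat + h.toNat) B, Nat.lt_succ_of_le (min_le_right _ _)⟩

/-- The two-way energy exchange channel with stochastic losses and replenishments and buffers of
capacities `B₁` and `B₂`. For a binary channel `W : Bool → PMF Bool`, `W a b` is the probability
`P^(ab)` that input `a` yields output `b`.
* `link₁₂`: law of the received symbol `Y₂` given the symbol `X₁` sent by Node 1;
* `link₂₁`: law of the received symbol `Y₁` given the symbol `X₂` sent by Node 2;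
* `harvest₁`, `harvest₂`: law of the energy `H_i` stored at Node `i` given `Y_i`. -/
structure Model (B₁ B₂ : ℕ) where
  link₁₂ : Bool → PMF Bool
  link₂₁ : Bool → PMF Bool
  harvest₁ : Bool → PMF Bool
  harvest₂ : Bool → PMF Bool

/-- The pair of battery levels. -/
abbrev State (B₁ B₂ : ℕ) : Type := Level B₁ × Level B₂

/-- One channel use: joint law of `(Y₁, Y₂, next state)` when the state is `u` and the nodes send
`x₁`, `x₂`. All loss and replenishment events are independent. -/
def Model.step {B₁ B₂ : ℕ} (W : Model B₁ B₂) (u : State B₁ B₂) (x₁ x₂ : Bool) :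
    PMF (Bool × Bool × State B₁ B₂) :=
  (W.link₂₁ x₂).bind fun y₁ => (W.link₁₂ x₁).bind fun y₂ =>
    (W.harvest₁ y₁).bind fun h₁ => (W.harvest₂ y₂).bind fun h₂ =>
      PMF.pure (y₁, y₂, nextLevel u.1 x₁ h₁, nextLevel u.2 x₂ h₂)

/-! ### Codes with local energy information -/

/-- A code of length `n` with local energy information: at channel use `k + 1`
(`k = 0, …, n - 1`) Node `j` maps its message, its `k` past received symbols and its `k + 1` past
and current *own* battery levels to a symbol, which must be `0` when its battery is empty. Node
`j` decodes the other message from its own message, its `n` received symbols and its `n` battery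
levels. (Encoding maps with index `k ≥ n` are never used.) -/
structure LEICode (B₁ B₂ n M₁ M₂ : ℕ) where
  enc₁ : Fin M₁ → (k : ℕ) → (Fin k → Bool) → (Fin (k + 1) → Level B₁) → Bool
  enc₂ : Fin M₂ → (k : ℕ) → (Fin k → Bool) → (Fin (k + 1) → Level B₂) → Bool
  enc₁_empty : ∀ m k y u, u (Fin.last k) = 0 → enc₁ m k y u = false
  enc₂_empty : ∀ m k y u, u (Fin.last k) = 0 → enc₂ m k y u = false
  dec₁ : Fin M₁ → (Fin n → Bool) → (Fin n → Level B₁) → Fin M₂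
  dec₂ : Fin M₂ → (Fin n → Bool) → (Fin n → Level B₂) → Fin M₁

/-- What both nodes have observed after `k` channel uses: `k` received symbols and `k + 1`
battery levels each. -/
structure History (B₁ B₂ k : ℕ) where
  y₁ : Fin k → Bool
  y₂ : Fin k → Bool
  u₁ : Fin (k + 1) → Level B₁
  u₂ : Fin (k + 1) → Level B₂

/-- Law of the history after `k` channel uses from the initial state `u₀`, when the code `C` is
used to send the messages `m₁` and `m₂`. -/
def Model.historyLaw {B₁ B₂ n M₁ M₂ : ℕ} (W : Model B₁ B₂) (u₀ : State B₁ B₂)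
    (C : LEICode B₁ B₂ n M₁ M₂) (m₁ : Fin M₁) (m₂ : Fin M₂) : (k : ℕ) → PMF (History B₁ B₂ k)
  | 0 => PMF.pure ⟨Fin.elim0, Fin.elim0, fun _ => u₀.1, fun _ => u₀.2⟩
  | k + 1 => (Model.historyLaw W u₀ C m₁ m₂ k).bind fun h =>
      (W.step (h.u₁ (Fin.last k), h.u₂ (Fin.last k))
          (C.enc₁ m₁ k h.y₁ h.u₁) (C.enc₂ m₂ k h.y₂ h.u₂)).map fun r =>
        ⟨Fin.snoc h.y₁ r.1, Fin.snoc h.y₂ r.2.1,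
          Fin.snoc h.u₁ r.2.2.1, Fin.snoc h.u₂ r.2.2.2⟩

/-- Probability that at least one of the two decoders errs, for independent uniform messages. -/
def Model.errorProb {B₁ B₂ n M₁ M₂ : ℕ} (W : Model B₁ B₂) (u₀ : State B₁ B₂)
    (C : LEICode B₁ B₂ n M₁ M₂) : ℝ :=
  (∑ m₁ : Fin M₁, ∑ m₂ : Fin M₂,
    ((W.historyLaw u₀ C m₁ m₂ n).toOuterMeasure
      {h | C.dec₂ m₂ h.y₂ (fun i => h.u₂ i.castSucc) ≠ m₁ ∨
           C.dec₁ m₁ h.y₁ (fun i => h.u₁ i.castSucc) ≠ m₂}).toReal) / ((M₁ : ℝ) * (M₂ : ℝ))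

/-- Number of messages at rate `R` bits per channel use and block length `n`. -/
def numMessages (n : ℕ) (R : ℝ) : ℕ := ⌈(2 : ℝ) ^ ((n : ℝ) * R)⌉₊

/-- A rate pair is achievable, from the initial state `u₀`, with codes in the class `S` if for all
large `n` some code of length `n` in the class has arbitrarily small error probability. -/
def Model.AchievableWith {B₁ B₂ : ℕ} (W : Model B₁ B₂) (u₀ : State B₁ B₂)
    (S : ∀ n M₁ M₂ : ℕ, LEICode B₁ B₂ n M₁ M₂ → Prop) (R : ℝ × ℝ) : Prop :=
  0 ≤ R.1 ∧ 0 ≤ R.2 ∧ ∀ ε : ℝ, 0 < ε → ∀ᶠ n : ℕ in Filter.atTop,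
    ∃ C : LEICode B₁ B₂ n (numMessages n R.1) (numMessages n R.2),
      S n _ _ C ∧ W.errorProb u₀ C ≤ ε

/-- Capacity region with local energy information. -/
def Model.capacityRegion {B₁ B₂ : ℕ} (W : Model B₁ B₂) (u₀ : State B₁ B₂) : Set (ℝ × ℝ) :=
  closure {R | W.AchievableWith u₀ (fun _ _ _ _ => True) R}

/-! ### Shannon strategies -/

/-- `f(v, u)`: the bit of the vector `v = (v(1), …, v(B))` at the current battery level `u`, and
`0` if `u = 0`. -/
def strategyMap {B : ℕ} (v : Fin B → Bool) (u : Level B) : Bool :=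
  Fin.cases (motive := fun _ => Bool) false v u

/-- The code consists of a codebook of `B_j`-bit vectors for each node `j`, the transmitted bit
being the one selected by the current local battery level, and of decoders that only look at the
received symbols. -/
def IsShannonCode {B₁ B₂ : ℕ} (n M₁ M₂ : ℕ) (C : LEICode B₁ B₂ n M₁ M₂) : Prop :=
  (∃ c₁ : Fin M₁ → Fin n → (Fin B₁ → Bool), ∀ (m : Fin M₁) (k : Fin n)
    (y : Fin (k : ℕ) → Bool) (u : Fin ((k : ℕ) + 1) → Level B₁),
      C.enc₁ m k y u = strategyMap (c₁ m k) (u (Fin.last k))) ∧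
  (∃ c₂ : Fin M₂ → Fin n → (Fin B₂ → Bool), ∀ (m : Fin M₂) (k : Fin n)
    (y : Fin (k : ℕ) → Bool) (u : Fin ((k : ℕ) + 1) → Level B₂),
      C.enc₂ m k y u = strategyMap (c₂ m k) (u (Fin.last k))) ∧
  (∃ g₁ : (Fin n → Bool) → Fin M₂, ∀ m y u, C.dec₁ m y u = g₁ y) ∧
  (∃ g₂ : (Fin n → Bool) → Fin M₁, ∀ m y u, C.dec₂ m y u = g₂ y)

/-- Closure of the set of rate pairs achievable with Shannon-strategy codes. -/
def Model.shannonRegion {B₁ B₂ : ℕ} (W : Model B₁ B₂) (u₀ : State B₁ B₂) : Set (ℝ × ℝ) :=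
  closure {R | W.AchievableWith u₀ (fun n M₁ M₂ C => IsShannonCode n M₁ M₂ C) R}

/-- Transition law of the Markov chain of battery states induced by random coding: at every channel
use the nodes draw independent `V₁ ∼ p₁`, `V₂ ∼ p₂` and send `f(V₁, u₁)`, `f(V₂, u₂)`. -/
def Model.chain {B₁ B₂ : ℕ} (W : Model B₁ B₂) (p₁ : PMF (Fin B₁ → Bool))
    (p₂ : PMF (Fin B₂ → Bool)) (u : State B₁ B₂) : PMF (State B₁ B₂) :=
  p₁.bind fun v₁ => p₂.bind fun v₂ =>
    (W.step u (strategyMap v₁ u.1) (strategyMap v₂ u.2)).map fun r => r.2.2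

/-- `t` can be reached from `s` in finitely many (possibly zero) steps of positive probability. -/
def Accessible {S : Type*} (K : S → PMF S) (s t : S) : Prop :=
  Relation.ReflTransGen (fun a b => b ∈ (K a).support) s t

/-- The chain with transition law `K` started at `s₀` is ergodic with steady-state distribution
`π`: `π` is the unique stationary distribution carried by the states accessible from `s₀`. -/
structure IsSteadyState {S : Type*} (K : S → PMF S) (s₀ : S) (π : PMF S) : Prop where
  stationary : π.bind K = π
  accessible : ∀ s ∈ π.support, Accessible K s₀ s
  unique : ∀ ρ : PMF S, ρ.bind K = ρ → (∀ s ∈ ρ.support, Accessible K s₀ s) → ρ = π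

/-- The distribution `p(v, y) = p(v) ∑_u π(u) p(y | f(v, u))`. -/
def jointDist {B : ℕ} (p : PMF (Fin B → Bool)) (π : PMF (Level B)) (W : Bool → PMF Bool)
    (v : Fin B → Bool) (y : Bool) : ℝ :=
  (p v).toReal * ∑ u : Level B, (π u).toReal * (W (strategyMap v u) y).toReal

/-- Mutual information, in bits, of a pair with joint probability mass function `q`. -/
def mutualInfo {α β : Type*} [Fintype α] [Fintype β] (q : α → β → ℝ) : ℝ :=
  ∑ a, ∑ b, q a b * Real.logb 2 (q a b / ((∑ b', q a b') * (∑ a', q a' b)))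

end EnergyExchange

end

noncomputable section

namespace EnergyExchange

/-! Random coding with mismatched threshold decoding. Each node draws i.i.d. strategy letters, and a
decoder accepts a codeword when its accumulated single-letter information density, computed with the
stationary law, exceeds a threshold. The true channel has memory, since the states couple both
directions, but memory matters only for the sent codeword.

A wrong codeword is independent of the received word, so Markov's inequality and the i.i.d. letters
bound its acceptance probability for every fixed word (`expect_ind_score_le`). No knowledge of the
true output law is needed.

The sent codeword needs a weak law of large numbers along the trajectory started at `u₀`. Uniqueness
of the stationary law makes the Poisson equation solvable on the accessible states
(`IsSteadyState.exists_poisson`). Adding its solution, evaluated at the current state, to the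
centred sum gives a martingale with bounded increments; Chebyshev's inequality finishes
(`Model.eventually_lower_tail`), with no mixing or aperiodicity.

The two combine in `eventually_exists_test`; `exists_codebooks` extracts deterministic codebooks
good for both directions. -/

open scoped Classical in
/-- The `0`-`1` indicator of a proposition. -/
def ind (P : Prop) : ℝ := if P then 1 else 0

lemma ind_nonneg (P : Prop) : 0 ≤ ind P := by unfold ind; split_ifs <;> norm_num

lemma ind_le_one (P : Prop) : ind P ≤ 1 := by unfold ind; split_ifs <;> norm_num

lemma ind_true {P : Prop} (h : P) : ind P = 1 := if_pos h

lemma ind_false {P : Prop} (h : ¬P) : ind P = 0 := if_neg h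

lemma ind_or_le (P Q : Prop) : ind (P ∨ Q) ≤ ind P + ind Q := by
  unfold ind; split_ifs <;> first | (exfalso; tauto) | norm_num

/-! ### Expectations over finite types -/

section Expect

variable {α β γ : Type*} [Fintype α] [Fintype β]

/-- Expectation of a real function under a probability mass function on a finite type. -/
def expect (p : PMF α) (f : α → ℝ) : ℝ := ∑ x, (p x).toReal * f x

lemma sum_toReal (p : PMF α) : ∑ x, (p x).toReal = 1 := by
  rw [← ENNReal.toReal_sum fun x _ => p.apply_ne_top x, ← tsum_fintype (L := .unconditional _),
    p.tsum_coe, ENNReal.toReal_one]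

lemma expect_const (p : PMF α) (c : ℝ) : expect p (fun _ => c) = c := by
  simp [expect, ← Finset.sum_mul, sum_toReal]

lemma expect_add (p : PMF α) (f g : α → ℝ) :
    expect p (fun x => f x + g x) = expect p f + expect p g := by
  simp [expect, mul_add, Finset.sum_add_distrib]

lemma expect_mul_left (p : PMF α) (c : ℝ) (f : α → ℝ) :
    expect p (fun x => c * f x) = c * expect p f := by
  simp only [expect, Finset.mul_sum]
  exact Finset.sum_congr rfl fun _ _ => by ring

lemma expect_mul_right (p : PMF α) (c : ℝ) (f : α → ℝ) :
    expect p (fun x => f x * c) = expect p f * c := by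
  simp only [mul_comm _ c, expect_mul_left]

lemma expect_sum {ι : Type*} (p : PMF α) (s : Finset ι) (f : ι → α → ℝ) :
    expect p (fun x => ∑ i ∈ s, f i x) = ∑ i ∈ s, expect p (f i) := by
  simp only [expect, Finset.mul_sum]
  exact Finset.sum_comm

lemma expect_comm (p : PMF α) (q : PMF β) (f : α → β → ℝ) :
    expect p (fun x => expect q (f x)) = expect q (fun y => expect p fun x => f x y) := by
  simp only [expect, Finset.mul_sum]
  rw [Finset.sum_comm]
  exact Finset.sum_congr rfl fun _ _ => Finset.sum_congr rfl fun _ _ => by ring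

lemma expect_mono_support (p : PMF α) {f g : α → ℝ} (h : ∀ x ∈ p.support, f x ≤ g x) :
    expect p f ≤ expect p g := by
  refine Finset.sum_le_sum fun x _ => ?_
  by_cases hx : p x = 0
  · simp [hx]
  · exact mul_le_mul_of_nonneg_left (h x ((p.mem_support_iff x).2 hx)) ENNReal.toReal_nonneg

lemma expect_mono (p : PMF α) {f g : α → ℝ} (h : ∀ x, f x ≤ g x) : expect p f ≤ expect p g :=
  expect_mono_support p fun x _ => h x

lemma expect_nonneg (p : PMF α) {f : α → ℝ} (h : ∀ x, 0 ≤ f x) : 0 ≤ expect p f :=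
  Finset.sum_nonneg fun x _ => mul_nonneg ENNReal.toReal_nonneg (h x)

lemma exists_le_expect (p : PMF α) (f : α → ℝ) : ∃ x, f x ≤ expect p f := by
  by_contra! h
  obtain ⟨x₀, hx₀⟩ := p.support_nonempty
  have : expect p (fun _ => expect p f) < expect p f := by
    refine Finset.sum_lt_sum
      (fun x _ => mul_le_mul_of_nonneg_left (h x).le ENNReal.toReal_nonneg)
      ⟨x₀, Finset.mem_univ _, mul_lt_mul_of_pos_left (h x₀) ?_⟩
    exact ENNReal.toReal_pos ((p.mem_support_iff _).1 hx₀) (p.apply_ne_top _)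
  rw [expect_const] at this
  exact lt_irrefl _ this

lemma expect_pure (a : α) (f : α → ℝ) : expect (PMF.pure a) f = f a := by
  classical
  rw [expect, Finset.sum_eq_single a]
  · simp
  · intro b _ hb; simp [hb]
  · simp

lemma toReal_bind (p : PMF α) (q : α → PMF γ) (c : γ) :
    (p.bind q c).toReal = ∑ x, (p x).toReal * (q x c).toReal := by
  rw [PMF.bind_apply, tsum_fintype, ENNReal.toReal_sum]
  · simp
  · exact fun x _ => ENNReal.mul_ne_top (p.apply_ne_top x) ((q x).apply_ne_top c)

lemma expect_bind (p : PMF α) (q : α → PMF β) (f : β → ℝ) :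
    expect (p.bind q) f = expect p fun x => expect (q x) f := by
  simp only [expect, toReal_bind, Finset.sum_mul, Finset.mul_sum]
  rw [Finset.sum_comm]
  exact Finset.sum_congr rfl fun _ _ => Finset.sum_congr rfl fun _ _ => by ring

lemma expect_map (p : PMF α) (e : α → β) (f : β → ℝ) :
    expect (p.map e) f = expect p fun x => f (e x) := by
  rw [PMF.map, expect_bind]
  simp [expect_pure]

lemma toReal_toOuterMeasure (p : PMF α) (s : Set α) :
    (p.toOuterMeasure s).toReal = expect p fun x => ind (x ∈ s) := by
  classical
  rw [PMF.toOuterMeasure_apply, tsum_fintype, ENNReal.toReal_sum]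
  · refine Finset.sum_congr rfl fun x _ => ?_
    by_cases hx : x ∈ s <;> simp [hx, ind]
  · intro x _
    by_cases hx : x ∈ s <;> simp [hx, p.apply_ne_top]

end Expect

/-! ### Words with independent letters -/

section Words

variable {α : Type*} [Fintype α]

/-- Law of a word of `n` independent letters with common law `p`. -/
def wordLaw {α : Type*} (p : PMF α) : (n : ℕ) → PMF (Fin n → α)
  | 0 => PMF.pure Fin.elim0
  | n + 1 => (wordLaw p n).bind fun v => p.map fun a => (Fin.snoc v a : Fin (n + 1) → α)

lemma expect_wordLaw_succ (p : PMF α) (n : ℕ) (f : (Fin (n + 1) → α) → ℝ) :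
    expect (wordLaw p (n + 1)) f =
      expect (wordLaw p n) fun v => expect p fun a => f (Fin.snoc v a) := by
  simp only [wordLaw, expect_bind, expect_map]

/-- Independence in product form; the one- and two-letter formulas below follow by setting the
remaining factors to 1. -/
lemma expect_wordLaw_prod (p : PMF α) : ∀ (n : ℕ) (f : Fin n → α → ℝ),
    expect (wordLaw p n) (fun v => ∏ i, f i (v i)) = ∏ i, expect p (f i)
  | 0, f => by simp [wordLaw, expect_pure]
  | n + 1, f => by
    simp only [expect_wordLaw_succ, Fin.prod_univ_castSucc, Fin.snoc_castSucc, Fin.snoc_last,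
      expect_mul_left, expect_mul_right]
    rw [expect_wordLaw_prod p n]

lemma expect_wordLaw_apply (p : PMF α) {n : ℕ} (i : Fin n) (f : α → ℝ) :
    expect (wordLaw p n) (fun v => f (v i)) = expect p f := by
  classical
  have h := expect_wordLaw_prod p n (fun j a => if j = i then f a else 1)
  have h₁ : ∀ j, expect p (fun a => if j = i then f a else 1) = if j = i then expect p f else 1 := by
    intro j
    split_ifs
    · rfl
    · exact expect_const p 1
  simpa [h₁] using h

lemma expect_wordLaw_mul (p : PMF α) {n : ℕ} {i j : Fin n} (hij : i ≠ j) (f g : α → ℝ) :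
    expect (wordLaw p n) (fun v => f (v i) * g (v j)) = expect p f * expect p g := by
  classical
  have h := expect_wordLaw_prod p n
    (fun k a => (if k = i then f a else 1) * (if k = j then g a else 1))
  have h₁ : ∀ k, expect p (fun a => (if k = i then f a else 1) * (if k = j then g a else 1)) =
      (if k = i then expect p f else 1) * (if k = j then expect p g else 1) := by
    intro k
    by_cases hi : k = i
    · subst hi; simp [hij]
    · by_cases hj : k = j
      · subst hj; simp [hi]
      · simp [hi, hj, expect_const]
  simp only [h₁, Finset.prod_mul_distrib, Finset.prod_ite_eq', Finset.mem_univ, if_true] at h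
  exact h

lemma expect_wordLaw_pair (p : PMF α) {n : ℕ} {i j : Fin n} (hij : i ≠ j) (f : α → α → ℝ) :
    expect (wordLaw p n) (fun v => f (v i) (v j)) =
      expect p fun a => expect p fun b => f a b := by
  -- Splitting over the value of one letter turns `f` into a sum of products.
  have h : ∀ v : Fin n → α, f (v i) (v j) = ∑ a, ind (v i = a) * f a (v j) := by
    intro v
    rw [Finset.sum_eq_single (v i)]
    · simp [ind]
    · intro b _ hb; rw [ind_false (Ne.symm hb), zero_mul]
    · simp
  simp only [h]
  rw [expect_sum]
  have h₂ : ∀ a, expect (wordLaw p n) (fun v => ind (v i = a) * f a (v j)) =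
      (p a).toReal * expect p fun b => f a b := by
    intro a
    rw [expect_wordLaw_mul p hij (fun x => ind (x = a)) (f a)]
    congr 1
    rw [expect, Finset.sum_eq_single a]
    · simp [ind]
    · intro b _ hb; rw [ind_false hb, mul_zero]
    · simp
  simp only [h₂]
  rfl

end Words

/-! ### Random coding -/

section Coding

variable {X Y : Type*}

open scoped Classical in
/-- The decoder that chooses a message whose codeword passes the test `T`. -/
def testDecoder {M : ℕ} [NeZero M] (T : X → Y → Prop) (c : Fin M → X) (y : Y) : Fin M :=
  if h : ∃ m, T (c m) y then h.choose else 0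

/-- If the sent codeword passes, the decoder picks some passing codeword, so an error exhibits a
wrong one that passes. The default output 0 arises only when the sent codeword fails, which the
first term pays for. -/
lemma ind_testDecoder_le {M : ℕ} [NeZero M] (T : X → Y → Prop) (c : Fin M → X) (y : Y)
    (m : Fin M) : ind (testDecoder T c y ≠ m) ≤
      ind (¬T (c m) y) + ∑ m' ∈ Finset.univ.erase m, ind (T (c m') y) := by
  have hs : ∀ m'', 0 ≤ ind (T (c m'') y) := fun _ => ind_nonneg _
  by_cases hT : T (c m) y
  · by_cases hd : testDecoder T c y = m
    · rw [ind_false (not_not.2 hd)]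
      exact add_nonneg (ind_nonneg _) (Finset.sum_nonneg fun _ _ => hs _)
    · have hex : ∃ m, T (c m) y := ⟨m, hT⟩
      have hc : T (c (testDecoder T c y)) y := by
        rw [testDecoder, dif_pos hex]; exact hex.choose_spec
      have := Finset.single_le_sum (f := fun m' => ind (T (c m') y)) (fun i _ => hs i)
        (Finset.mem_erase.2 ⟨hd, Finset.mem_univ _⟩)
      rw [ind_true hd, ind_false (not_not.2 hT), zero_add, ← ind_true hc]
      exact this
  · rw [ind_true hT]
    have := Finset.sum_nonneg (s := Finset.univ.erase m) fun i _ => hs i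
    linarith [ind_le_one (testDecoder T c y ≠ m)]

variable [Fintype X] [Fintype Y]

/-- The output depends on the codebook only through `c m`, hence is independent of every other
codeword; a bound `b` uniform in `y` therefore suffices, whatever `Q` is. -/
lemma expect_testDecoder_le {M : ℕ} [NeZero M] (p : PMF X) (Q : X → PMF Y) (T : X → Y → Prop)
    {a b : ℝ} (ha : expect p (fun x => expect (Q x) fun y => ind (¬T x y)) ≤ a)
    (hb : ∀ y, expect p (fun x => ind (T x y)) ≤ b) (m : Fin M) :
    expect (wordLaw p M) (fun c => expect (Q (c m)) fun y => ind (testDecoder T c y ≠ m)) ≤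
      a + (M - 1) * b := by
  have h₁ : ∀ m' ∈ Finset.univ.erase m,
      expect (wordLaw p M) (fun c => expect (Q (c m)) fun y => ind (T (c m') y)) ≤ b := by
    intro m' hm'
    rw [expect_wordLaw_pair p (Finset.ne_of_mem_erase hm').symm
      (fun x x' => expect (Q x) fun y => ind (T x' y))]
    calc _ = expect p (fun x => expect (Q x) fun y => expect p fun x' => ind (T x' y)) := by
          congr 1; funext x; exact expect_comm _ _ _
      _ ≤ expect p (fun x => expect (Q x) fun _ => b) :=
          expect_mono _ fun x => expect_mono _ fun y => hb y
      _ = b := by simp only [expect_const]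
  calc _ ≤ expect (wordLaw p M) (fun c => expect (Q (c m)) fun y =>
        ind (¬T (c m) y) + ∑ m' ∈ Finset.univ.erase m, ind (T (c m') y)) :=
        expect_mono _ fun c => expect_mono _ fun y => ind_testDecoder_le T c y m
    _ = expect p (fun x => expect (Q x) fun y => ind (¬T x y)) +
        ∑ m' ∈ Finset.univ.erase m,
          expect (wordLaw p M) (fun c => expect (Q (c m)) fun y => ind (T (c m') y)) := by
        simp only [expect_add, expect_sum]
        rw [expect_wordLaw_apply p m (fun x => expect (Q x) fun y => ind (¬T x y))]
    _ ≤ a + ∑ m' ∈ Finset.univ.erase m, b := add_le_add ha (Finset.sum_le_sum h₁)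
    _ = a + (M - 1) * b := by
        rw [Finset.sum_const, Finset.card_erase_of_mem (Finset.mem_univ _), Finset.card_univ,
          Fintype.card_fin, nsmul_eq_mul, Nat.cast_sub (NeZero.one_le), Nat.cast_one]

/-- Random coding for a two-way channel `Q` whose decoders ignore their own messages. -/
lemma exists_codebooks {X₁ X₂ Y₁ Y₂ : Type*} [Fintype X₁] [Fintype X₂] [Fintype Y₁] [Fintype Y₂]
    {M₁ M₂ : ℕ} [NeZero M₁] [NeZero M₂] (p₁ : PMF X₁) (p₂ : PMF X₂)
    (Q₁ : X₁ → X₂ → PMF Y₁) (Q₂ : X₁ → X₂ → PMF Y₂)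
    (T₁ : X₁ → Y₂ → Prop) (T₂ : X₂ → Y₁ → Prop) {a₁ a₂ b₁ b₂ : ℝ}
    (ha₁ : expect p₁ (fun x₁ => expect p₂ fun x₂ => expect (Q₂ x₁ x₂) fun y => ind (¬T₁ x₁ y)) ≤ a₁)
    (ha₂ : expect p₁ (fun x₁ => expect p₂ fun x₂ => expect (Q₁ x₁ x₂) fun y => ind (¬T₂ x₂ y)) ≤ a₂)
    (hb₁ : ∀ y, expect p₁ (fun x => ind (T₁ x y)) ≤ b₁)
    (hb₂ : ∀ y, expect p₂ (fun x => ind (T₂ x y)) ≤ b₂) :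
    ∃ (c₁ : Fin M₁ → X₁) (c₂ : Fin M₂ → X₂) (g₁ : Y₁ → Fin M₂) (g₂ : Y₂ → Fin M₁),
      (∑ m₁, ∑ m₂, (expect (Q₂ (c₁ m₁) (c₂ m₂)) (fun y => ind (g₂ y ≠ m₁)) +
        expect (Q₁ (c₁ m₁) (c₂ m₂)) (fun y => ind (g₁ y ≠ m₂)))) / ((M₁ : ℝ) * M₂) ≤
      (a₁ + (M₁ - 1) * b₁) + (a₂ + (M₂ - 1) * b₂) := by
  set F : (Fin M₁ → X₁) → (Fin M₂ → X₂) → ℝ := fun c₁ c₂ =>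
    (∑ m₁, ∑ m₂, (expect (Q₂ (c₁ m₁) (c₂ m₂)) (fun y => ind (testDecoder T₁ c₁ y ≠ m₁)) +
        expect (Q₁ (c₁ m₁) (c₂ m₂)) (fun y => ind (testDecoder T₂ c₂ y ≠ m₂)))) with hF
  have hM₁ : (0 : ℝ) < M₁ := Nat.cast_pos.2 (NeZero.pos M₁)
  have hM₂ : (0 : ℝ) < M₂ := Nat.cast_pos.2 (NeZero.pos M₂)
  have hE : expect (wordLaw p₁ M₁) (fun c₁ => expect (wordLaw p₂ M₂) fun c₂ => F c₁ c₂) ≤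
      ((a₁ + (M₁ - 1) * b₁) + (a₂ + (M₂ - 1) * b₂)) * (M₁ * M₂) := by
    simp only [hF, expect_sum, expect_add]
    calc _ ≤ ∑ m₁ : Fin M₁, ∑ m₂ : Fin M₂,
          ((a₁ + (M₁ - 1) * b₁) + (a₂ + (M₂ - 1) * b₂)) := by
          refine Finset.sum_le_sum fun m₁ _ => Finset.sum_le_sum fun m₂ _ => add_le_add ?_ ?_
          -- For fixed messages only one codeword of the other node matters; averaging over it makes
          -- it part of the channel noise.
          · have := expect_testDecoder_le p₁ (fun x₁ => p₂.bind fun x₂ => Q₂ x₁ x₂) T₁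
              (a := a₁) (b := b₁) (by simpa only [expect_bind] using ha₁) hb₁ m₁
            simp only [expect_bind] at this
            refine le_trans (le_of_eq ?_) this
            congr 1; funext c₁
            exact expect_wordLaw_apply p₂ m₂
              (fun x₂ => expect (Q₂ (c₁ m₁) x₂) fun y => ind (testDecoder T₁ c₁ y ≠ m₁))
          · have := expect_testDecoder_le p₂ (fun x₂ => p₁.bind fun x₁ => Q₁ x₁ x₂) T₂
              (a := a₂) (b := b₂) (by
                simp only [expect_bind]
                rw [expect_comm]; exact ha₂) hb₂ m₂
            simp only [expect_bind] at this
            refine le_trans (le_of_eq ?_) this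
            rw [expect_comm]
            congr 1; funext c₂
            exact expect_wordLaw_apply p₁ m₁
              (fun x₁ => expect (Q₁ x₁ (c₂ m₂)) fun y => ind (testDecoder T₂ c₂ y ≠ m₂))
      _ = _ := by simp; ring
  obtain ⟨c₁, hc₁⟩ := exists_le_expect (wordLaw p₁ M₁) fun c₁ => expect (wordLaw p₂ M₂) (F c₁)
  obtain ⟨c₂, hc₂⟩ := exists_le_expect (wordLaw p₂ M₂) (F c₁)
  refine ⟨c₁, c₂, testDecoder T₂ c₂, testDecoder T₁ c₁, ?_⟩
  rw [div_le_iff₀ (mul_pos hM₁ hM₂)]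
  exact (hc₂.trans hc₁).trans hE

end Coding

/-! ### The Poisson equation of an ergodic finite chain -/

section Poisson

variable {S : Type*} [Fintype S] {K : S → PMF S} {s₀ : S} {π : PMF S}

/-- Normalising a nonzero `ν` gives a stationary pmf, to which uniqueness applies. -/
lemma IsSteadyState.eq_of_nonneg (hπ : IsSteadyState K s₀ π) {ν : S → ℝ} (h0 : ∀ s, 0 ≤ ν s)
    (hinv : ∀ t, ∑ s, ν s * (K s t).toReal = ν t)
    (hacc : ∀ s, ν s ≠ 0 → Accessible K s₀ s) : ∀ s, ν s = (∑ t, ν t) * (π s).toReal := by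
  have hsum : 0 ≤ ∑ t, ν t := Finset.sum_nonneg fun t _ => h0 t
  rcases hsum.eq_or_lt with hz | hpos
  · intro s
    rw [← hz, zero_mul]
    exact (Finset.sum_eq_zero_iff_of_nonneg fun t _ => h0 t).1 hz.symm s (Finset.mem_univ _)
  set c := ∑ t, ν t with hc
  have hd : ∀ s, 0 ≤ ν s / c := fun s => div_nonneg (h0 s) hpos.le
  let ρ : PMF S := PMF.ofFintype (fun s => ENNReal.ofReal (ν s / c)) (by
    rw [← ENNReal.ofReal_sum_of_nonneg fun s _ => hd s, ← Finset.sum_div, div_self hpos.ne',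
      ENNReal.ofReal_one])
  have hρ : ∀ s, (ρ s).toReal = ν s / c := fun s => by
    simp only [ρ, PMF.ofFintype_apply, ENNReal.toReal_ofReal (hd s)]
  have hρπ : ρ = π := by
    refine hπ.unique ρ ?_ ?_
    · ext t
      rw [← ENNReal.toReal_eq_toReal_iff' (PMF.apply_ne_top _ _) (PMF.apply_ne_top _ _),
        toReal_bind, hρ, ← hinv t, Finset.sum_div]
      exact Finset.sum_congr rfl fun s _ => by rw [hρ]; ring
    · intro s hs
      refine hacc s fun h => ?_
      apply (PMF.mem_support_iff _ _).1 hs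
      simp [ρ, h]
  intro s
  rw [← hρπ, hρ]
  field_simp

/-- The triangle inequality gives `|μ| ≤ |μ|K` pointwise, and both sides have equal total mass
because `K` is stochastic. So `|μ|` is invariant too, and `|μ| ± μ` are nonnegative invariant
measures. -/
lemma IsSteadyState.exists_eq_mul (hπ : IsSteadyState K s₀ π) {μ : S → ℝ}
    (hinv : ∀ t, ∑ s, μ s * (K s t).toReal = μ t)
    (hacc : ∀ s, μ s ≠ 0 → Accessible K s₀ s) : ∃ c, ∀ s, μ s = c * (π s).toReal := by
  have hle : ∀ t ∈ Finset.univ, |μ t| ≤ ∑ s, |μ s| * (K s t).toReal := by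
    intro t _
    rw [← hinv t]
    refine (Finset.abs_sum_le_sum_abs _ _).trans (le_of_eq ?_)
    exact Finset.sum_congr rfl fun s _ => by rw [abs_mul, abs_of_nonneg ENNReal.toReal_nonneg]
  have hsum : ∑ t, |μ t| = ∑ t, ∑ s, |μ s| * (K s t).toReal := by
    rw [Finset.sum_comm]
    exact Finset.sum_congr rfl fun s _ => by rw [← Finset.mul_sum, sum_toReal, mul_one]
  have habs : ∀ t, ∑ s, |μ s| * (K s t).toReal = |μ t| := fun t =>
    ((Finset.sum_eq_sum_iff_of_le hle).1 hsum t (Finset.mem_univ _)).symm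
  have h₁ := hπ.eq_of_nonneg (ν := fun s => |μ s| + μ s) (fun s => by linarith [neg_abs_le (μ s)])
    (fun t => by simp only [add_mul, Finset.sum_add_distrib, habs, hinv])
    (fun s hs => hacc s fun h => hs (by simp [h]))
  have h₂ := hπ.eq_of_nonneg (ν := fun s => |μ s| - μ s) (fun s => by linarith [le_abs_self (μ s)])
    (fun t => by simp only [sub_mul, Finset.sum_sub_distrib, habs, hinv])
    (fun s hs => hacc s fun h => hs (by simp [h]))
  refine ⟨((∑ t, (|μ t| + μ t)) - ∑ t, (|μ t| - μ t)) / 2, fun s => ?_⟩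
  linarith [h₁ s, h₂ s]

-- Fredholm alternative for `I - K` on the accessible states: a functional annihilating the range is
-- an invariant signed measure, hence a multiple of `π`, and so annihilates the centred `f`.
open scoped Classical in
lemma IsSteadyState.exists_poisson (hπ : IsSteadyState K s₀ π) (f : S → ℝ) :
    ∃ φ : S → ℝ, ∀ s, Accessible K s₀ s → f s - expect π f = φ s - expect (K s) φ := by
  let T : (S → ℝ) →ₗ[ℝ] (S → ℝ) :=
    { toFun := fun φ s => if Accessible K s₀ s then φ s - expect (K s) φ else 0
      map_add' := fun φ ψ => by
        ext s
        have h : expect (K s) (φ + ψ) = expect (K s) φ + expect (K s) ψ := expect_add _ _ _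
        simp only [Pi.add_apply, h]
        split_ifs <;> ring
      map_smul' := fun c φ => by
        ext s
        have h : expect (K s) (c • φ) = c * expect (K s) φ := expect_mul_left _ _ _
        simp only [Pi.smul_apply, smul_eq_mul, h, RingHom.id_apply]
        split_ifs <;> ring }
  have hT : ∀ φ s, T φ s = if Accessible K s₀ s then φ s - expect (K s) φ else 0 := fun _ _ => rfl
  let F : S → ℝ := fun s => if Accessible K s₀ s then f s - expect π f else 0
  suffices h : F ∈ LinearMap.range T by
    obtain ⟨φ, hφ⟩ := h
    refine ⟨φ, fun s hs => ?_⟩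
    have := congrFun hφ s
    simp only [hT, F, if_pos hs] at this
    exact this.symm
  by_contra hF
  obtain ⟨l, hlF, hl⟩ := Submodule.exists_le_ker_of_notMem hF
  have hlsum : ∀ g, l g = ∑ s, g s * l (Pi.single s 1) := fun g => by
    conv_lhs => rw [LinearMap.pi_apply_eq_sum_univ l g]
    refine Finset.sum_congr rfl fun s _ => ?_
    rw [smul_eq_mul]
    congr 2
    ext t
    simp [Pi.single_apply, eq_comm]
  -- Cutting `l` down to accessible states loses nothing, as `T φ` and `F` vanish elsewhere; `l ∘ T
  -- = 0` then says that `μ` is invariant.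
  let μ : S → ℝ := fun s => if Accessible K s₀ s then l (Pi.single s 1) else 0
  have hμ : ∀ φ : S → ℝ, ∑ s, μ s * φ s = ∑ s, μ s * expect (K s) φ := by
    intro φ
    have h0 : l (T φ) = 0 := hl ⟨φ, rfl⟩
    rw [hlsum] at h0
    rw [← sub_eq_zero, ← h0, ← Finset.sum_sub_distrib]
    refine Finset.sum_congr rfl fun s _ => ?_
    simp only [hT, μ]
    split_ifs <;> ring
  obtain ⟨c, hc⟩ := hπ.exists_eq_mul (μ := μ)
    (fun t => by
      have h := hμ (Pi.single t 1)
      have hs : ∀ s, expect (K s) (Pi.single t 1) = (K s t).toReal := fun s => by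
        simp [expect, Pi.single_apply]
      simp only [hs] at h
      rw [← h]
      simp [Pi.single_apply])
    (fun s hs => by
      by_contra h
      exact hs (if_neg h))
  apply hlF
  have h1 : l F = ∑ s, μ s * (f s - expect π f) := by
    rw [hlsum]
    refine Finset.sum_congr rfl fun s _ => ?_
    simp only [F, μ]
    split_ifs <;> ring
  have h2 : ∑ s, μ s * (f s - expect π f) = c * expect π (fun s => f s + -expect π f) := by
    generalize expect π f = e
    rw [expect, Finset.mul_sum]
    exact Finset.sum_congr rfl fun s _ => by rw [hc]; ring
  rw [h1, h2, expect_add, expect_const]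
  ring

end Poisson

/-! ### The random-coding process -/

section Trajectory

variable {B₁ B₂ : ℕ} (W : Model B₁ B₂)

/-- Law of the received words and of the current state after `n` channel uses, when the nodes
follow the given words of strategies. -/
def Model.traj (u₀ : State B₁ B₂) : (n : ℕ) → (Fin n → Fin B₁ → Bool) → (Fin n → Fin B₂ → Bool) →
    PMF ((Fin n → Bool) × (Fin n → Bool) × State B₁ B₂)
  | 0 => fun _ _ => PMF.pure (Fin.elim0, Fin.elim0, u₀)
  | n + 1 => fun v₁ v₂ =>
    (Model.traj u₀ n (fun i => v₁ i.castSucc) (fun i => v₂ i.castSucc)).bind fun t =>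
      (W.step t.2.2 (strategyMap (v₁ (Fin.last n)) t.2.2.1)
        (strategyMap (v₂ (Fin.last n)) t.2.2.2)).map fun r =>
          (Fin.snoc t.1 r.1, Fin.snoc t.2.1 r.2.1, r.2.2)

variable (p₁ : PMF (Fin B₁ → Bool)) (p₂ : PMF (Fin B₂ → Bool))

/-- Expectation over one channel use from the state `u` with random strategies. -/
def Model.expectUse (u : State B₁ B₂)
    (f : (Fin B₁ → Bool) → (Fin B₂ → Bool) → Bool × Bool × State B₁ B₂ → ℝ) : ℝ :=
  expect p₁ fun a => expect p₂ fun b =>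
    expect (W.step u (strategyMap a u.1) (strategyMap b u.2)) (f a b)

/-- Expectation over `n` channel uses with random strategies. -/
def Model.expectTraj (u₀ : State B₁ B₂) (n : ℕ)
    (f : (Fin n → Fin B₁ → Bool) → (Fin n → Fin B₂ → Bool) →
      (Fin n → Bool) × (Fin n → Bool) × State B₁ B₂ → ℝ) : ℝ :=
  expect (wordLaw p₁ n) fun v₁ => expect (wordLaw p₂ n) fun v₂ =>
    expect (W.traj u₀ n v₁ v₂) (f v₁ v₂)

lemma Model.expectTraj_zero (u₀ : State B₁ B₂)
    (f : (Fin 0 → Fin B₁ → Bool) → (Fin 0 → Fin B₂ → Bool) →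
      (Fin 0 → Bool) × (Fin 0 → Bool) × State B₁ B₂ → ℝ) :
    W.expectTraj p₁ p₂ u₀ 0 f = f Fin.elim0 Fin.elim0 (Fin.elim0, Fin.elim0, u₀) := by
  simp only [Model.expectTraj, wordLaw, Model.traj, expect_pure]

lemma Model.expectTraj_succ (u₀ : State B₁ B₂) (n : ℕ)
    (f : (Fin (n + 1) → Fin B₁ → Bool) → (Fin (n + 1) → Fin B₂ → Bool) →
      (Fin (n + 1) → Bool) × (Fin (n + 1) → Bool) × State B₁ B₂ → ℝ) :
    W.expectTraj p₁ p₂ u₀ (n + 1) f = W.expectTraj p₁ p₂ u₀ n fun v₁ v₂ t =>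
      W.expectUse p₁ p₂ t.2.2 fun a b r => f (Fin.snoc v₁ a) (Fin.snoc v₂ b)
        (Fin.snoc t.1 r.1, Fin.snoc t.2.1 r.2.1, r.2.2) := by
  simp only [Model.expectTraj, Model.expectUse, expect_wordLaw_succ, Model.traj, expect_bind,
    expect_map, Fin.snoc_castSucc, Fin.snoc_last]
  congr 1; funext v₁
  rw [expect_comm]
  congr 1; funext v₂
  rw [← expect_comm p₁]
  congr 1; funext a
  exact expect_comm _ _ _

lemma Model.expect_chain (u : State B₁ B₂) (φ : State B₁ B₂ → ℝ) :
    expect (W.chain p₁ p₂ u) φ = W.expectUse p₁ p₂ u fun _ _ r => φ r.2.2 := by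
  simp only [Model.chain, Model.expectUse, expect_bind, expect_map]

lemma Model.expectUse_mono_support {u : State B₁ B₂}
    {f g : (Fin B₁ → Bool) → (Fin B₂ → Bool) → Bool × Bool × State B₁ B₂ → ℝ}
    (h : ∀ a b r, r.2.2 ∈ (W.chain p₁ p₂ u).support → f a b r ≤ g a b r) :
    W.expectUse p₁ p₂ u f ≤ W.expectUse p₁ p₂ u g := by
  refine expect_mono_support _ fun a ha => expect_mono_support _ fun b hb =>
    expect_mono_support _ fun r hr => h a b r ?_
  simp only [Model.chain, PMF.mem_support_bind_iff, PMF.mem_support_map_iff]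
  exact ⟨a, ha, b, hb, r, hr, rfl⟩

lemma Model.expectTraj_mono_accessible (u₀ : State B₁ B₂) : ∀ (n : ℕ)
    {f g : (Fin n → Fin B₁ → Bool) → (Fin n → Fin B₂ → Bool) →
      (Fin n → Bool) × (Fin n → Bool) × State B₁ B₂ → ℝ},
    (∀ v₁ v₂ t, Accessible (W.chain p₁ p₂) u₀ t.2.2 → f v₁ v₂ t ≤ g v₁ v₂ t) →
    W.expectTraj p₁ p₂ u₀ n f ≤ W.expectTraj p₁ p₂ u₀ n g
  | 0, f, g, h => by
    rw [W.expectTraj_zero, W.expectTraj_zero]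
    exact h _ _ _ Relation.ReflTransGen.refl
  | n + 1, f, g, h => by
    rw [W.expectTraj_succ, W.expectTraj_succ]
    refine Model.expectTraj_mono_accessible u₀ n fun v₁ v₂ t ht =>
      W.expectUse_mono_support p₁ p₂ fun a b r hr => h _ _ _ ?_
    exact Relation.ReflTransGen.tail ht hr

lemma Model.expectUse_add (u : State B₁ B₂)
    (f g : (Fin B₁ → Bool) → (Fin B₂ → Bool) → Bool × Bool × State B₁ B₂ → ℝ) :
    W.expectUse p₁ p₂ u (fun a b r => f a b r + g a b r) =
      W.expectUse p₁ p₂ u f + W.expectUse p₁ p₂ u g := by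
  simp only [Model.expectUse, expect_add]

lemma Model.expectUse_mul_left (u : State B₁ B₂) (c : ℝ)
    (f : (Fin B₁ → Bool) → (Fin B₂ → Bool) → Bool × Bool × State B₁ B₂ → ℝ) :
    W.expectUse p₁ p₂ u (fun a b r => c * f a b r) = c * W.expectUse p₁ p₂ u f := by
  simp only [Model.expectUse, expect_mul_left]

lemma Model.expectUse_const (u : State B₁ B₂) (c : ℝ) :
    W.expectUse p₁ p₂ u (fun _ _ _ => c) = c := by
  simp only [Model.expectUse, expect_const]

variable {p₁ p₂}

/-- The accumulated deviation of an additive functional from its stationary mean has a second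
moment that grows at most linearly, after correction by a bounded function of the state. -/
lemma Model.exists_second_moment_bound {u₀ : State B₁ B₂} {π : PMF (State B₁ B₂)}
    (hπ : IsSteadyState (W.chain p₁ p₂) u₀ π)
    (g : (Fin B₁ → Bool) → (Fin B₂ → Bool) → Bool → Bool → ℝ) :
    ∃ (φ : State B₁ B₂ → ℝ) (C : ℝ), ∀ n : ℕ, W.expectTraj p₁ p₂ u₀ n (fun v₁ v₂ t =>
      (∑ i, (g (v₁ i) (v₂ i) (t.1 i) (t.2.1 i) -
        expect π fun u => W.expectUse p₁ p₂ u fun a b r => g a b r.1 r.2.1) + φ t.2.2) ^ 2) ≤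
      C * (n + 1) := by
  obtain ⟨φ, hφ⟩ := hπ.exists_poisson
    fun u => W.expectUse p₁ p₂ u fun a b r => g a b r.1 r.2.1
  set m := expect π fun u => W.expectUse p₁ p₂ u fun a b r => g a b r.1 r.2.1 with hm
  -- Martingale increment: the Poisson equation gives it mean zero from every accessible state.
  let D : State B₁ B₂ → (Fin B₁ → Bool) → (Fin B₂ → Bool) → Bool × Bool × State B₁ B₂ → ℝ :=
    fun u a b r => g a b r.1 r.2.1 - m + φ r.2.2 - φ u
  have hD0 : ∀ u, Accessible (W.chain p₁ p₂) u₀ u → W.expectUse p₁ p₂ u (D u) = 0 := by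
    intro u hu
    have h := hφ u hu
    rw [W.expect_chain] at h
    have h' : D u = fun a b r => (g a b r.1 r.2.1 + φ r.2.2) + (-m - φ u) := by
      funext a b r; simp only [D]; ring
    rw [h', W.expectUse_add, W.expectUse_add, W.expectUse_const]
    linarith
  obtain ⟨c, hc⟩ : ∃ c, ∀ x : State B₁ B₂ × (Fin B₁ → Bool) × (Fin B₂ → Bool) ×
      (Bool × Bool × State B₁ B₂), (D x.1 x.2.1 x.2.2.1 x.2.2.2) ^ 2 ≤ c := by
    obtain ⟨c, hc⟩ := (Set.finite_range fun x : State B₁ B₂ × (Fin B₁ → Bool) × (Fin B₂ → Bool) ×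
      (Bool × Bool × State B₁ B₂) => (D x.1 x.2.1 x.2.2.1 x.2.2.2) ^ 2).bddAbove
    exact ⟨c, fun x => hc ⟨x, rfl⟩⟩
  refine ⟨φ, φ u₀ ^ 2 + c, fun n => ?_⟩
  have hcpos : 0 ≤ c := (sq_nonneg _).trans (hc (u₀, fun _ => true, fun _ => true, true, true, u₀))
  have key : ∀ n : ℕ, W.expectTraj p₁ p₂ u₀ n (fun v₁ v₂ t =>
      (∑ i, (g (v₁ i) (v₂ i) (t.1 i) (t.2.1 i) - m) + φ t.2.2) ^ 2) ≤ φ u₀ ^ 2 + n * c := by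
    intro n
    induction n with
    | zero => rw [W.expectTraj_zero]; simp
    | succ n ih =>
      rw [W.expectTraj_succ]
      calc _ ≤ W.expectTraj p₁ p₂ u₀ n (fun v₁ v₂ t =>
            (∑ i, (g (v₁ i) (v₂ i) (t.1 i) (t.2.1 i) - m) + φ t.2.2) ^ 2 + c) := by
            refine W.expectTraj_mono_accessible p₁ p₂ u₀ n fun v₁ v₂ t ht => ?_
            simp only [Fin.sum_univ_castSucc, Fin.snoc_castSucc, Fin.snoc_last]
            set Z := ∑ i, (g (v₁ i) (v₂ i) (t.1 i) (t.2.1 i) - m) with hZ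
            -- The new corrected sum is `Z + φ t.2.2 + D`; on squaring, the cross term has mean zero
            -- and `D ^ 2 ≤ c`.
            calc _ ≤ W.expectUse p₁ p₂ t.2.2 (fun a b r =>
                  ((Z + φ t.2.2) ^ 2 + c) + 2 * (Z + φ t.2.2) * D t.2.2 a b r) := by
                  refine W.expectUse_mono_support p₁ p₂ fun a b r _ => ?_
                  have := hc (t.2.2, a, b, r)
                  simp only [D] at this ⊢
                  nlinarith
              _ = _ := by
                  rw [W.expectUse_add, W.expectUse_const, W.expectUse_mul_left, hD0 _ ht,
                    mul_zero, add_zero]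
        _ = W.expectTraj p₁ p₂ u₀ n (fun v₁ v₂ t =>
            (∑ i, (g (v₁ i) (v₂ i) (t.1 i) (t.2.1 i) - m) + φ t.2.2) ^ 2) + c := by
            simp only [Model.expectTraj, expect_add, expect_const]
        _ ≤ φ u₀ ^ 2 + (n + 1 : ℕ) * c := by push_cast; linarith
  refine (key n).trans ?_
  nlinarith [sq_nonneg (φ u₀), mul_nonneg (Nat.cast_nonneg (α := ℝ) n) (sq_nonneg (φ u₀))]

open Filter in
/-- Weak law of large numbers (lower tail) for additive functionals of the random-coding
process. -/
lemma Model.eventually_lower_tail {u₀ : State B₁ B₂} {π : PMF (State B₁ B₂)}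
    (hπ : IsSteadyState (W.chain p₁ p₂) u₀ π)
    (g : (Fin B₁ → Bool) → (Fin B₂ → Bool) → Bool → Bool → ℝ) {θ : ℝ}
    (hθ : θ < expect π fun u => W.expectUse p₁ p₂ u fun a b r => g a b r.1 r.2.1)
    {ε : ℝ} (hε : 0 < ε) :
    ∀ᶠ n : ℕ in atTop, W.expectTraj p₁ p₂ u₀ n (fun v₁ v₂ t =>
      ind (∑ i, g (v₁ i) (v₂ i) (t.1 i) (t.2.1 i) < n * θ)) ≤ ε := by
  obtain ⟨φ, C, hC⟩ := W.exists_second_moment_bound hπ g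
  set m := expect π fun u => W.expectUse p₁ p₂ u fun a b r => g a b r.1 r.2.1 with hm
  obtain ⟨c, hc⟩ := (Set.finite_range φ).bddAbove
  replace hc : ∀ u, φ u ≤ c := fun u => hc ⟨u, rfl⟩
  -- Half of the gap absorbs the correction `φ ≤ n * η` for large `n`; the other half is left for
  -- Chebyshev.
  set η := (m - θ) / 2 with hη
  have hηpos : 0 < η := by rw [hη]; linarith
  have hlim : Tendsto (fun n : ℕ => (C / η ^ 2) * (((n : ℝ) + 1) / (n : ℝ) ^ 2)) atTop (nhds 0) := by
    have h1 : Tendsto (fun n : ℕ => (1 : ℝ) / n + (1 / n) * (1 / n)) atTop (nhds (0 + 0 * 0)) :=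
      tendsto_one_div_atTop_nhds_zero_nat.add
        (tendsto_one_div_atTop_nhds_zero_nat.mul tendsto_one_div_atTop_nhds_zero_nat)
    have h2 := h1.const_mul (C / η ^ 2)
    rw [mul_zero, add_zero, mul_zero] at h2
    refine h2.congr' ?_
    filter_upwards [eventually_gt_atTop 0] with n hn
    have : (n : ℝ) ≠ 0 := by positivity
    field_simp
  filter_upwards [hlim.eventually_le_const hε, eventually_gt_atTop 0,
    tendsto_natCast_atTop_atTop.eventually_ge_atTop (c / η)] with n hn hn0 hnc
  have hn0' : (0 : ℝ) < n := Nat.cast_pos.2 hn0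
  rw [div_le_iff₀ hηpos] at hnc
  refine le_trans ?_ hn
  have hpos : 0 < (n * η) ^ 2 := by positivity
  calc _ ≤ W.expectTraj p₁ p₂ u₀ n (fun v₁ v₂ t => (1 / (n * η) ^ 2) *
        (∑ i, (g (v₁ i) (v₂ i) (t.1 i) (t.2.1 i) - m) + φ t.2.2) ^ 2) := by
        refine W.expectTraj_mono_accessible p₁ p₂ u₀ n fun v₁ v₂ t _ => ?_
        by_cases h : ∑ i, g (v₁ i) (v₂ i) (t.1 i) (t.2.1 i) < n * θ
        · rw [ind_true h, one_div, inv_mul_eq_div, le_div_iff₀ hpos, one_mul]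
          have h1 : ∑ i, (g (v₁ i) (v₂ i) (t.1 i) (t.2.1 i) - m) + φ t.2.2 ≤ -(n * η) := by
            have := hc t.2.2
            rw [Finset.sum_sub_distrib, Finset.sum_const, Finset.card_univ, Fintype.card_fin,
              nsmul_eq_mul]
            have : (n : ℝ) * m = n * θ + 2 * (n * η) := by rw [hη]; ring
            linarith
          have h2 : 0 ≤ (n : ℝ) * η := by positivity
          nlinarith
        · rw [ind_false h]; positivity
    _ = (1 / (n * η) ^ 2) * W.expectTraj p₁ p₂ u₀ n (fun v₁ v₂ t =>
        (∑ i, (g (v₁ i) (v₂ i) (t.1 i) (t.2.1 i) - m) + φ t.2.2) ^ 2) := by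
        simp only [Model.expectTraj, expect_mul_left]
    _ ≤ (1 / (n * η) ^ 2) * (C * (n + 1)) := mul_le_mul_of_nonneg_left (hC n) (by positivity)
    _ = _ := by field_simp

end Trajectory

/-! ### Smoothed information density -/

section Density

variable {B : ℕ} (p : PMF (Fin B → Bool)) (ρ : PMF (Level B)) (L : Bool → PMF Bool)

lemma jointDist_nonneg (v : Fin B → Bool) (y : Bool) : 0 ≤ jointDist p ρ L v y :=
  mul_nonneg ENNReal.toReal_nonneg
    (Finset.sum_nonneg fun _ _ => mul_nonneg ENNReal.toReal_nonneg ENNReal.toReal_nonneg)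

lemma sum_jointDist_mul (F : (Fin B → Bool) → Bool → ℝ) :
    ∑ v, ∑ y, jointDist p ρ L v y * F v y =
      expect p fun v => expect ρ fun u => expect (L (strategyMap v u)) (F v) := by
  refine Finset.sum_congr rfl fun v _ => ?_
  simp only [jointDist, expect, Finset.mul_sum, Finset.sum_mul]
  rw [Finset.sum_comm]
  exact Finset.sum_congr rfl fun _ _ => Finset.sum_congr rfl fun _ _ => by ring

lemma sum_jointDist_right (v : Fin B → Bool) : ∑ y, jointDist p ρ L v y = (p v).toReal := by
  simp only [jointDist]
  rw [← Finset.mul_sum, Finset.sum_comm]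
  simp only [← Finset.mul_sum, sum_toReal, mul_one]

lemma sum_jointDist : ∑ v, ∑ y, jointDist p ρ L v y = 1 := by
  simp only [sum_jointDist_right, sum_toReal]

/-- Likelihood ratio of the joint distribution against the product of its marginals. -/
def likelihoodRatio (v : Fin B → Bool) (y : Bool) : ℝ :=
  jointDist p ρ L v y / ((∑ y', jointDist p ρ L v y') * ∑ v', jointDist p ρ L v' y)

lemma likelihoodRatio_nonneg (v : Fin B → Bool) (y : Bool) : 0 ≤ likelihoodRatio p ρ L v y :=
  div_nonneg (jointDist_nonneg ..) (mul_nonneg (Finset.sum_nonneg fun _ _ => jointDist_nonneg ..)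
    (Finset.sum_nonneg fun _ _ => jointDist_nonneg ..))

lemma likelihoodRatio_pos {v : Fin B → Bool} {y : Bool} (h : 0 < jointDist p ρ L v y) :
    0 < likelihoodRatio p ρ L v y :=
  div_pos h (mul_pos
    (h.trans_le (Finset.single_le_sum (f := fun y' => jointDist p ρ L v y')
      (fun _ _ => jointDist_nonneg ..) (Finset.mem_univ y)))
    (h.trans_le (Finset.single_le_sum (f := fun v' => jointDist p ρ L v' y)
      (fun _ _ => jointDist_nonneg ..) (Finset.mem_univ v))))

/-- The weight `p v` cancels the first marginal, leaving the conditional law of `v` given `y`. Its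
mass is 1, or 0 when `y` has probability zero, hence the inequality. -/
lemma expect_likelihoodRatio_le (y : Bool) : expect p (fun v => likelihoodRatio p ρ L v y) ≤ 1 := by
  calc _ ≤ ∑ v, jointDist p ρ L v y / ∑ v', jointDist p ρ L v' y := by
        refine Finset.sum_le_sum fun v _ => ?_
        simp only [likelihoodRatio, sum_jointDist_right]
        by_cases hv : (p v).toReal = 0
        · simp [hv, jointDist]
        · refine le_of_eq ?_
          field_simp
    _ ≤ 1 := by rw [← Finset.sum_div]; exact div_self_le_one _

/-- Binary logarithm of the likelihood ratio, smoothed so that it is finite everywhere. -/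
def score (s : ℝ) (v : Fin B → Bool) (y : Bool) : ℝ :=
  Real.logb 2 (s * likelihoodRatio p ρ L v y + (1 - s))

variable {s : ℝ}

lemma rpow_score (hs0 : 0 < s) (hs1 : s < 1) (v : Fin B → Bool) (y : Bool) :
    (2 : ℝ) ^ score p ρ L s v y = s * likelihoodRatio p ρ L v y + (1 - s) :=
  Real.rpow_logb (by norm_num) (by norm_num)
    (add_pos_of_nonneg_of_pos (mul_nonneg hs0.le (likelihoodRatio_nonneg ..)) (sub_pos.2 hs1))

/-- Dropping `1 - s` inside the logarithm shows that smoothing costs at most `-logb 2 s` on average.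
-/
lemma mutualInfo_add_le (hs0 : 0 < s) (hs1 : s < 1) :
    mutualInfo (jointDist p ρ L) + Real.logb 2 s ≤
      ∑ v, ∑ y, jointDist p ρ L v y * score p ρ L s v y := by
  have h : mutualInfo (jointDist p ρ L) + Real.logb 2 s = ∑ v, ∑ y, jointDist p ρ L v y *
      (Real.logb 2 (likelihoodRatio p ρ L v y) + Real.logb 2 s) := by
    simp only [mul_add, Finset.sum_add_distrib, ← Finset.sum_mul, sum_jointDist, one_mul]
    rfl
  rw [h]
  refine Finset.sum_le_sum fun v _ => Finset.sum_le_sum fun y _ => ?_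
  rcases (jointDist_nonneg p ρ L v y).eq_or_lt with h0 | h0
  · simp [← h0]
  · refine mul_le_mul_of_nonneg_left ?_ h0.le
    have hr := likelihoodRatio_pos p ρ L h0
    rw [← Real.logb_mul hr.ne' hs0.ne', mul_comm]
    exact Real.logb_le_logb_of_le (by norm_num) (mul_pos hs0 hr) (by linarith)

/-- An independent codeword passes the threshold test with exponentially small probability,
whatever the received word. -/
lemma expect_ind_score_le (hs0 : 0 < s) (hs1 : s < 1) (n : ℕ) (t : ℝ) (y : Fin n → Bool) :
    expect (wordLaw p n) (fun v => ind (t ≤ ∑ i, score p ρ L s (v i) (y i))) ≤ 2 ^ (-t) := by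
  calc _ ≤ expect (wordLaw p n) (fun v =>
        (2 : ℝ) ^ (-t) * ∏ i, (s * likelihoodRatio p ρ L (v i) (y i) + (1 - s))) := by
        refine expect_mono _ fun v => ?_
        simp only [← rpow_score p ρ L hs0 hs1]
        rw [← Real.rpow_sum_of_pos (by norm_num), ← Real.rpow_add (by norm_num)]
        by_cases h : t ≤ ∑ i, score p ρ L s (v i) (y i)
        · rw [ind_true h]
          exact Real.one_le_rpow (by norm_num) (by linarith)
        · rw [ind_false h]; positivity
    _ = 2 ^ (-t) * ∏ i, expect p (fun v => s * likelihoodRatio p ρ L v (y i) + (1 - s)) := by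
        rw [expect_mul_left,
          expect_wordLaw_prod p n (fun i v => s * likelihoodRatio p ρ L v (y i) + (1 - s))]
    _ ≤ 2 ^ (-t) * 1 := by
        refine mul_le_mul_of_nonneg_left (Finset.prod_le_one (fun i _ => ?_) fun i _ => ?_)
          (by positivity)
        · exact expect_nonneg _ fun v => add_nonneg
            (mul_nonneg hs0.le (likelihoodRatio_nonneg ..)) (sub_nonneg.2 hs1.le)
        · rw [expect_add, expect_mul_left, expect_const]
          nlinarith [expect_likelihoodRatio_le p ρ L (y i)]
    _ = _ := mul_one _

lemma numMessages_sub_one_le (n : ℕ) (R : ℝ) :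
    (numMessages n R : ℝ) - 1 ≤ 2 ^ ((n : ℝ) * R) := by
  have := Nat.ceil_lt_add_one (a := (2 : ℝ) ^ ((n : ℝ) * R)) (by positivity)
  rw [numMessages]
  linarith

open Filter in
/-- If the information density obeys a lower-tail law of large numbers under the functionals
`E n`, then for each rate below the mutual information there are tests that accept the sent
codeword and reject independent codewords. -/
lemma eventually_exists_test (E : ∀ n, ((Fin n → Fin B → Bool) → (Fin n → Bool) → ℝ) → ℝ)
    (hE0 : ∀ n, E n (fun _ _ => 0) = 0)
    (hE : ∀ (g : (Fin B → Bool) → Bool → ℝ) (θ : ℝ), θ < ∑ v, ∑ y, jointDist p ρ L v y * g v y →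
      ∀ ε > 0, ∀ᶠ n : ℕ in atTop, E n (fun v y => ind (∑ i, g (v i) (y i) < n * θ)) ≤ ε)
    {R : ℝ} (hR : R = 0 ∨ R < mutualInfo (jointDist p ρ L)) {ε : ℝ} (hε : 0 < ε) :
    ∀ᶠ n : ℕ in atTop, ∃ (T : (Fin n → Fin B → Bool) → (Fin n → Bool) → Prop) (b : ℝ),
      E n (fun v y => ind (¬T v y)) ≤ ε ∧
      (∀ y, expect (wordLaw p n) (fun v => ind (T v y)) ≤ b) ∧
      ((numMessages n R : ℝ) - 1) * b ≤ ε := by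
  rcases hR with rfl | hR
  -- At rate zero there is exactly one message, so the factor `numMessages n R - 1` vanishes and
  -- accepting everything works.
  · refine Eventually.of_forall fun n => ⟨fun _ _ => True, 1, ?_, fun y => ?_, ?_⟩
    · simp only [not_true_eq_false, ind_false not_false, hE0, hε.le]
    · simp only [ind_true trivial, expect_const, le_refl]
    · simp [numMessages, hε.le]
  set I := mutualInfo (jointDist p ρ L) with hI
  -- One `δ` pays for smoothing, one keeps the threshold `R + δ` strictly below the mean score, and
  -- one gives the union bound its decay `2 ^ (-nδ) = s ^ n`.
  obtain ⟨δ, hδ, hδI⟩ : ∃ δ, 0 < δ ∧ R + 3 * δ = I := ⟨(I - R) / 3, by linarith, by ring⟩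
  set s : ℝ := 2 ^ (-δ) with hs
  have hs0 : 0 < s := by positivity
  have hs1 : s < 1 := Real.rpow_lt_one_of_one_lt_of_neg (by norm_num) (by linarith)
  have hlog : Real.logb 2 s = -δ := Real.logb_rpow (by norm_num) (by norm_num)
  have hmean : R + δ < ∑ v, ∑ y, jointDist p ρ L v y * score p ρ L s v y := by
    have := mutualInfo_add_le p ρ L hs0 hs1
    rw [hlog] at this
    linarith
  have hlim := (tendsto_pow_atTop_nhds_zero_of_lt_one hs0.le hs1).eventually_le_const hε
  filter_upwards [hE _ _ hmean ε hε, hlim] with n hn hnlim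
  refine ⟨fun v y => n * (R + δ) ≤ ∑ i, score p ρ L s (v i) (y i), 2 ^ (-((n : ℝ) * (R + δ))), ?_,
    fun y => expect_ind_score_le p ρ L hs0 hs1 n _ y, ?_⟩
  · simpa only [not_le] using hn
  · calc _ ≤ (2 : ℝ) ^ ((n : ℝ) * R) * 2 ^ (-((n : ℝ) * (R + δ))) :=
          mul_le_mul_of_nonneg_right (numMessages_sub_one_le n R) (by positivity)
      _ = s ^ n := by
          rw [← Real.rpow_add (by norm_num), hs, ← Real.rpow_natCast, ← Real.rpow_mul (by norm_num)]
          congr 1; ring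
      _ ≤ ε := hnlim

end Density

/-! ### Shannon-strategy codes -/

section Codes

variable {B₁ B₂ : ℕ} (W : Model B₁ B₂)

/-- The Shannon-strategy code with given codebooks and decoders. -/
def shannonCode {n M₁ M₂ : ℕ} (c₁ : Fin M₁ → Fin n → Fin B₁ → Bool)
    (c₂ : Fin M₂ → Fin n → Fin B₂ → Bool) (g₁ : (Fin n → Bool) → Fin M₂)
    (g₂ : (Fin n → Bool) → Fin M₁) : LEICode B₁ B₂ n M₁ M₂ where
  enc₁ m k _ u := if h : k < n then strategyMap (c₁ m ⟨k, h⟩) (u (Fin.last k)) else false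
  enc₂ m k _ u := if h : k < n then strategyMap (c₂ m ⟨k, h⟩) (u (Fin.last k)) else false
  enc₁_empty m k y u h := by rw [h]; split_ifs <;> rfl
  enc₂_empty m k y u h := by rw [h]; split_ifs <;> rfl
  dec₁ _ y _ := g₁ y
  dec₂ _ y _ := g₂ y

variable {n M₁ M₂ : ℕ} (c₁ : Fin M₁ → Fin n → Fin B₁ → Bool)
    (c₂ : Fin M₂ → Fin n → Fin B₂ → Bool) (g₁ : (Fin n → Bool) → Fin M₂)
    (g₂ : (Fin n → Bool) → Fin M₁)

lemma isShannonCode_shannonCode : IsShannonCode n M₁ M₂ (shannonCode c₁ c₂ g₁ g₂) :=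
  ⟨⟨c₁, fun _ k _ _ => dif_pos k.2⟩, ⟨c₂, fun _ k _ _ => dif_pos k.2⟩,
    ⟨g₁, fun _ _ _ => rfl⟩, ⟨g₂, fun _ _ _ => rfl⟩⟩

/-- The encoders read only the current level, so past levels can be forgotten. -/
lemma Model.historyLaw_shannonCode (u₀ : State B₁ B₂) (m₁ : Fin M₁) (m₂ : Fin M₂) :
    ∀ (k : ℕ) (hk : k ≤ n), (W.historyLaw u₀ (shannonCode c₁ c₂ g₁ g₂) m₁ m₂ k).map
      (fun h => (h.y₁, h.y₂, (h.u₁ (Fin.last k), h.u₂ (Fin.last k)))) =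
      W.traj u₀ k (fun i => c₁ m₁ (Fin.castLE hk i)) (fun i => c₂ m₂ (Fin.castLE hk i))
  | 0, _ => by simp only [Model.historyLaw, Model.traj, PMF.pure_map]
  | k + 1, hk => by
    have hkn : k < n := hk
    have ih := Model.historyLaw_shannonCode u₀ m₁ m₂ k hkn.le
    simp only [Model.traj]
    erw [← ih]
    simp only [Model.historyLaw, PMF.map_bind, PMF.bind_map, PMF.map_comp]
    congr 1; funext h
    simp only [shannonCode, dif_pos hkn, Function.comp_def, Fin.snoc_last]
    rfl

lemma Model.errorProb_shannonCode_le (u₀ : State B₁ B₂) :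
    W.errorProb u₀ (shannonCode c₁ c₂ g₁ g₂) ≤
      (∑ m₁, ∑ m₂,
        (expect ((W.traj u₀ n (c₁ m₁) (c₂ m₂)).map fun t => t.2.1) (fun y => ind (g₂ y ≠ m₁)) +
        expect ((W.traj u₀ n (c₁ m₁) (c₂ m₂)).map fun t => t.1) (fun y => ind (g₁ y ≠ m₂)))) /
      ((M₁ : ℝ) * M₂) := by
  refine div_le_div_of_nonneg_right (Finset.sum_le_sum fun m₁ _ => Finset.sum_le_sum fun m₂ _ => ?_)
    (by positivity)
  have h := W.historyLaw_shannonCode c₁ c₂ g₁ g₂ u₀ m₁ m₂ n le_rfl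
  have h' := PMF.toOuterMeasure_map_apply
    (fun h : History B₁ B₂ n => (h.y₁, h.y₂, (h.u₁ (Fin.last n), h.u₂ (Fin.last n))))
    (W.historyLaw u₀ (shannonCode c₁ c₂ g₁ g₂) m₁ m₂ n)
    {t | g₂ t.2.1 ≠ m₁ ∨ g₁ t.1 ≠ m₂}
  rw [h] at h'
  refine (congrArg ENNReal.toReal h'.symm).le.trans ?_
  rw [toReal_toOuterMeasure, expect_map, expect_map, ← expect_add]
  exact expect_mono _ fun t => ind_or_le _ _

lemma Model.expect_step_y₂ (u : State B₁ B₂) (x₁ x₂ : Bool) (F : Bool → ℝ) :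
    expect (W.step u x₁ x₂) (fun r => F r.2.1) = expect (W.link₁₂ x₁) F := by
  simp only [Model.step, expect_bind, expect_pure, expect_const]

lemma Model.expect_step_y₁ (u : State B₁ B₂) (x₁ x₂ : Bool) (F : Bool → ℝ) :
    expect (W.step u x₁ x₂) (fun r => F r.1) = expect (W.link₂₁ x₂) F := by
  simp only [Model.step, expect_bind, expect_pure, expect_const]

instance numMessages_neZero (n : ℕ) (R : ℝ) : NeZero (numMessages n R) :=
  ⟨(Nat.ceil_pos.2 (by positivity)).ne'⟩

variable {p₁ : PMF (Fin B₁ → Bool)} {p₂ : PMF (Fin B₂ → Bool)} {u₀ : State B₁ B₂}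
  {π : PMF (State B₁ B₂)}

/-- Rates that are zero or strictly below the mutual informations are achievable with
Shannon-strategy codes. -/
theorem Model.achievable_of_lt (hπ : IsSteadyState (W.chain p₁ p₂) u₀ π) {R₁ R₂ : ℝ}
    (hR₁ : 0 ≤ R₁) (hR₂ : 0 ≤ R₂)
    (h₁ : R₁ = 0 ∨ R₁ < mutualInfo (jointDist p₁ (π.map Prod.fst) W.link₁₂))
    (h₂ : R₂ = 0 ∨ R₂ < mutualInfo (jointDist p₂ (π.map Prod.snd) W.link₂₁)) :
    W.AchievableWith u₀ (fun n M₁ M₂ C => IsShannonCode n M₁ M₂ C) (R₁, R₂) := by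
  refine ⟨hR₁, hR₂, fun ε hε => ?_⟩
  -- Each of the two decoders has two error sources: rejecting the sent codeword and accepting a
  -- wrong one.
  have hε4 : 0 < ε / 4 := by linarith
  have t₁ := eventually_exists_test p₁ (π.map Prod.fst) W.link₁₂
    (fun n F => W.expectTraj p₁ p₂ u₀ n fun v₁ _ t => F v₁ t.2.1)
    (fun n => by simp only [Model.expectTraj, expect_const])
    (fun g θ hθ ε hε => by
      refine W.eventually_lower_tail hπ (fun a _ _ y => g a y) (hθ.trans_le (le_of_eq ?_)) hε
      simp only [sum_jointDist_mul, expect_map, Model.expectUse, W.expect_step_y₂, expect_const]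
      exact expect_comm _ _ _)
    h₁ hε4
  have t₂ := eventually_exists_test p₂ (π.map Prod.snd) W.link₂₁
    (fun n F => W.expectTraj p₁ p₂ u₀ n fun _ v₂ t => F v₂ t.1)
    (fun n => by simp only [Model.expectTraj, expect_const])
    (fun g θ hθ ε hε => by
      refine W.eventually_lower_tail hπ (fun _ b y _ => g b y) (hθ.trans_le (le_of_eq ?_)) hε
      simp only [sum_jointDist_mul, expect_map, Model.expectUse, W.expect_step_y₁, expect_const]
      exact expect_comm _ _ _)
    h₂ hε4
  filter_upwards [t₁, t₂] with n hn₁ hn₂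
  obtain ⟨T₁, b₁, ha₁, hb₁, hM₁⟩ := hn₁
  obtain ⟨T₂, b₂, ha₂, hb₂, hM₂⟩ := hn₂
  obtain ⟨c₁, c₂, g₁, g₂, h⟩ := exists_codebooks (M₁ := numMessages n R₁) (M₂ := numMessages n R₂)
    (wordLaw p₁ n) (wordLaw p₂ n)
    (fun v₁ v₂ => (W.traj u₀ n v₁ v₂).map fun t => t.1)
    (fun v₁ v₂ => (W.traj u₀ n v₁ v₂).map fun t => t.2.1) T₁ T₂
    (by simpa only [expect_map, Model.expectTraj] using ha₁) (by simpa only [expect_map, Model.expectTraj] using ha₂) hb₁ hb₂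
  refine ⟨shannonCode c₁ c₂ g₁ g₂, isShannonCode_shannonCode .., ?_⟩
  refine (W.errorProb_shannonCode_le ..).trans (h.trans ?_)
  linarith

lemma Model.shannonRegion_subset_capacityRegion (u₀ : State B₁ B₂) :
    W.shannonRegion u₀ ⊆ W.capacityRegion u₀ :=
  closure_mono fun _ hR => ⟨hR.1, hR.2.1, fun ε hε =>
    (hR.2.2 ε hε).mono fun _ ⟨C, _, hC⟩ => ⟨C, trivial, hC⟩⟩

lemma eq_zero_or_mul_lt {R I t : ℝ} (hR : 0 ≤ R) (hI : R ≤ I) (ht : t < 1) :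
    t * R = 0 ∨ t * R < I := by
  rcases hR.eq_or_lt with rfl | hR
  · exact Or.inl (mul_zero t)
  · exact Or.inr (by nlinarith)

theorem Model.mem_shannonRegion (hπ : IsSteadyState (W.chain p₁ p₂) u₀ π) {R₁ R₂ : ℝ}
    (hR₁ : 0 ≤ R₁) (hR₂ : 0 ≤ R₂)
    (h₁ : R₁ ≤ mutualInfo (jointDist p₁ (π.map Prod.fst) W.link₁₂))
    (h₂ : R₂ ≤ mutualInfo (jointDist p₂ (π.map Prod.snd) W.link₂₁)) :
    (R₁, R₂) ∈ W.shannonRegion u₀ := by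
  -- Shrinking by a factor below 1 makes a positive rate strictly smaller than its bound and leaves
  -- a zero rate at zero, whence the two alternatives in `Model.achievable_of_lt`.
  have hlim : Filter.Tendsto (fun n : ℕ => (((n : ℝ) / (n + 1)) * R₁, ((n : ℝ) / (n + 1)) * R₂))
      Filter.atTop (nhds (1 * R₁, 1 * R₂)) :=
    (tendsto_natCast_div_add_atTop (1 : ℝ)).mul_const R₁ |>.prodMk_nhds
      ((tendsto_natCast_div_add_atTop (1 : ℝ)).mul_const R₂)
  rw [one_mul, one_mul] at hlim
  refine mem_closure_of_tendsto hlim (Filter.Eventually.of_forall fun n => ?_)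
  have h0 : (0 : ℝ) ≤ (n : ℝ) / (n + 1) := by positivity
  have h1 : (n : ℝ) / (n + 1) < 1 := by rw [div_lt_one (by positivity)]; linarith
  exact W.achievable_of_lt hπ (mul_nonneg h0 hR₁) (mul_nonneg h0 hR₂)
    (eq_zero_or_mul_lt hR₁ h₁ h1) (eq_zero_or_mul_lt hR₂ h₂ h1)

end Codes

end EnergyExchange

end

theorem mainTheorem4 {B₁ B₂ : ℕ} (W : EnergyExchange.Model B₁ B₂)
    (u₀ : EnergyExchange.State B₁ B₂)
    (p₁ : PMF (Fin B₁ → Bool)) (p₂ : PMF (Fin B₂ → Bool))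
    (π : PMF (EnergyExchange.State B₁ B₂))
    (hπ : EnergyExchange.IsSteadyState (W.chain p₁ p₂) u₀ π)
    (R₁ R₂ : ℝ) (hR₁ : 0 ≤ R₁) (hR₂ : 0 ≤ R₂)
    (h₁ : R₁ ≤ EnergyExchange.mutualInfo
      (EnergyExchange.jointDist p₁ (π.map Prod.fst) W.link₁₂))
    (h₂ : R₂ ≤ EnergyExchange.mutualInfo
      (EnergyExchange.jointDist p₂ (π.map Prod.snd) W.link₂₁)) :
    (R₁, R₂) ∈ W.shannonRegion u₀ ∧ (R₁, R₂) ∈ W.capacityRegion u₀ :=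
  have h := W.mem_shannonRegion hπ hR₁ hR₂ h₁ h₂
  ⟨h, W.shannonRegion_subset_capacityRegion u₀ h⟩
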